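/- Let $G$ be a real, connected, compact, semisimple Lie group of dimension $3$, with Lie algebra $\mathfrak g$. Call the orbit of a flow $\psi_t$ through $g\in G$ periodic if it is not reduced to the point $g$ and there is $T>0$ with $\psi_{t+T}(g)=\psi_t(g)$ for all $t\in\mathbb R$. (i) For every $X\in\mathfrak g$, the flow of the right invariant vector field on $G$ with value $X$ at the identity (that is, of the differential equation $\dot g=X(g)$) is defined for all times and is given by $g\mapsto \exp(tX)\,g$. If $X\neq 0$, then every orbit of this flow is periodic. (If $X=0$, every point is fixed.) (ii) Let $\mathcal X$ be a linear vector field on $G$, that is, a smooth vector field whose flow $(\varphi_t)_{t\in\mathbb R}$ consists of automorphisms of the Lie group $G$. Then every orbit of $\varphi_t$ is either a fixed point or periodic. -/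

import Mathlib

open scoped Manifold ContDiff

noncomputable section

section LieGroupFlows

variable {E : Type*} [NormedAddCommGroup E] [NormedSpace ℝ E]
  {H : Type*} [TopologicalSpace H] (I : ModelWithCorners ℝ E H)
  {G : Type*} [TopologicalSpace G] [ChartedSpace H G] [Group G]

/-- A smooth real Lie group has the smoothness that Mathlib asks for in order to equip the tangent
space at the identity, `GroupLieAlgebra I G`, with its Lie algebra structure. -/
instance instLieGroupMinSmoothnessThree [LieGroup I ∞ G] : LieGroup I (minSmoothness ℝ 3) G :=
  LieGroup.of_le (m := minSmoothness ℝ 3) (n := ∞)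
    (by
      rw [minSmoothness_of_isRCLikeNormedField]
      exact WithTop.coe_le_coe.2 (le_top : (3 : ℕ∞) ≤ ⊤))

/-- The right invariant vector field with value `v` at the identity: its value at `g` is the image
of `v` under the differential at `1` of the right translation `x ↦ x * g`. -/
def rightInvariantVectorField (v : GroupLieAlgebra I G) (g : G) : TangentSpace I g :=
  (mfderiv I I (fun x : G => x * g) 1 v : TangentSpace I ((1 : G) * g))

/-- `φ` is the global flow of the vector field `V`: for each `g`, the curve `t ↦ φ t g` is the
integral curve of `V`, defined for all times, that starts at `g`. -/
structure IsFlowOf (V : (g : G) → TangentSpace I g) (φ : ℝ → G → G) : Prop where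
  map_zero : ∀ g, φ 0 g = g
  isMIntegralCurve : ∀ g, IsMIntegralCurve (I := I) (fun t => φ t g) V

/-- `f` is an automorphism of the Lie group `G`: a group automorphism that is smooth together with
its inverse. -/
def IsLieGroupAutomorphism (f : G → G) : Prop :=
  ∃ ψ : G ≃* G, ContMDiff I I ∞ ψ ∧ ContMDiff I I ∞ ψ.symm ∧ ∀ g, ψ g = f g

/-- A smooth vector field on `G` is linear if its flow consists of automorphisms of the Lie group
`G`. -/
structure IsLinearVectorField [LieGroup I ∞ G] (V : (g : G) → TangentSpace I g) : Prop where
  contMDiff : ContMDiff I I.tangent ∞ (fun g => (⟨g, V g⟩ : TangentBundle I G))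
  exists_flow : ∃ φ : ℝ → G → G, IsFlowOf I V φ ∧ ∀ t, IsLieGroupAutomorphism I (φ t)

/-- The exponential map of the Lie group `G`: the value at time `1` of the integral curve through
the identity of the right invariant vector field given by `v` (this curve is the one-parameter
subgroup with velocity `v` at `0`). -/
def lieGroupExp (v : GroupLieAlgebra I G) : G :=
  Classical.epsilon (fun γ : ℝ → G =>
    γ 0 = 1 ∧ IsMIntegralCurve (I := I) γ (rightInvariantVectorField I v)) 1

end LieGroupFlows

/-- The orbit described by the trajectory `γ` is periodic: it is not reduced to a point, and `γ` has
a period `T > 0`. -/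
def IsPeriodicOrbit {M : Type*} (γ : ℝ → M) : Prop :=
  (∃ t, γ t ≠ γ 0) ∧ ∃ T : ℝ, 0 < T ∧ ∀ t, γ (t + T) = γ t

end

/-! No classification of the group is used; everything comes from half-turns in the adjoint
representation. By compactness `Ad` is orthogonal in some basis. Along a one-parameter subgroup it
takes values in SO(3), so it is either trivial there or meets a half-turn
(`oneParameter_trivial_or_halfTurn`). Triviality along `exp (tv)` would make this subgroup central
and `v` fixed by `Ad`, so `v = 0` by semisimplicity. Hence every axis carries a half-turn `Ad n`
(`exists_halfTurn`).

For (i), some `c = exp (Tx)` with `T > 0` has `Ad c = 1`, so `c` is central. A half-turn about an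
axis orthogonal to `x` sends `x` to `-x`, so `c = n c n⁻¹ = c⁻¹` and `2T` is a period.

For (ii), let `D` be the differential at `1` of an automorphism in the flow. Then `Dᵀ D` commutes
with `Ad`, hence is a scalar `μ²`, because the half-turns generate all matrices. On the axis of the
rotation `μ⁻¹ D` the automorphism rescales a periodic subgroup by `μ`, which forces `μ = 1`. So the
differentials form a one-parameter group of rotations and have a period `T`; an automorphism of a
connected group with identity differential is the identity. -/

/-! ### Rotations of three-space and one-parameter groups of them -/

section SpecialOrthogonal

open Matrix

/-- The trace of the adjugate is the second symmetric function of the eigenvalues, and the adjugate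
of a rotation is its transpose. With trace `1 + 2 cos θ` this is the double-angle formula. -/
theorem trace_mul_self_of_orthogonal {R : Matrix (Fin 3) (Fin 3) ℝ} (hR : Rᵀ * R = 1)
    (hdet : R.det = 1) : (R * R).trace = R.trace ^ 2 - 2 * R.trace := by
  have hadj : R.adjugate = Rᵀ := by
    have h := congrArg (Rᵀ * ·) (mul_adjugate R)
    simp only [← mul_assoc, hR, hdet, one_mul, one_smul, mul_one] at h
    exact h
  have key : (R * R).trace = R.trace ^ 2 - 2 * R.adjugate.trace := by
    simp only [trace_fin_three, adjugate_fin_three, mul_apply, Fin.sum_univ_three]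
    simp
    ring
  rw [key, hadj, trace_transpose]

/-- The squared Frobenius norm of `R - 1` is `6 - 2 tr R`. -/
theorem eq_one_of_orthogonal_of_trace {R : Matrix (Fin 3) (Fin 3) ℝ} (hR : Rᵀ * R = 1)
    (htr : R.trace = 3) : R = 1 := by
  have h : ((R - 1)ᴴ * (R - 1)).trace = 0 := by
    have : (R - 1)ᴴ * (R - 1) = Rᵀ * R - Rᵀ - R + 1 := by
      rw [conjTranspose_eq_transpose_of_trivial, transpose_sub, transpose_one]
      noncomm_ring
    rw [this, hR, trace_add, trace_sub, trace_sub, trace_transpose, htr]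
    simp
  exact sub_eq_zero.1 (trace_conjTranspose_mul_self_eq_zero_iff.1 h)

/-- A one-parameter group of rotations of the space, with continuous trace, is trivial or contains
a half-turn. -/
theorem oneParameter_trivial_or_halfTurn {R : ℝ → Matrix (Fin 3) (Fin 3) ℝ} (h0 : R 0 = 1)
    (hadd : ∀ s t, R (s + t) = R s * R t) (horth : ∀ t, (R t)ᵀ * R t = 1)
    (hdet : ∀ t, (R t).det = 1) (hcont : Continuous fun t => (R t).trace) :
    (∀ t, R t = 1) ∨ ∃ t, (R t).trace = -1 := by
  by_contra! hcon
  obtain ⟨⟨t₁, ht₁⟩, hne⟩ := hcon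
  -- `f t` is the cosine of the rotation angle of `R t`.
  set f : ℝ → ℝ := fun t => ((R t).trace - 1) / 2 with hf
  have hfc : Continuous f := by fun_prop
  have hf0 : f 0 = 1 := by simp [hf, h0]; norm_num
  have hdouble : ∀ t, f (2 * t) = 2 * f t ^ 2 - 1 := by
    intro t
    simp only [hf]
    rw [two_mul, hadd, trace_mul_self_of_orthogonal (horth t) (hdet t)]
    ring
  -- A nonpositive value would give a zero `s` of `f`, and then `R (2 * s)` would be a half-turn.
  have hpos : ∀ t, 0 < f t := by
    intro t
    by_contra! hle
    obtain ⟨s, hs⟩ : ∃ s, f s = 0 :=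
      mem_range_of_exists_le_of_exists_ge hfc ⟨t, hle⟩ ⟨0, by rw [hf0]; norm_num⟩
    apply hne (2 * s)
    have := hdouble s
    rw [hs] at this
    simp only [hf] at this
    linarith
  have hle : ∀ t, f t ≤ 1 := by
    intro t
    have hdiag : ∀ i, R t i i ≤ 1 := by
      intro i
      have h := congrFun (congrFun (horth t) i) i
      simp only [mul_apply, transpose_apply, one_apply_eq] at h
      have h1 := Finset.single_le_sum (f := fun j => R t j i * R t j i)
        (fun j _ => mul_self_nonneg _) (Finset.mem_univ i)
      nlinarith
    simp only [hf, trace_fin_three]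
    linarith [hdiag 0, hdiag 1, hdiag 2]
  have hlt : f t₁ < 1 := by
    refine lt_of_le_of_ne (hle t₁) fun h => ht₁ (eq_one_of_orthogonal_of_trace (horth t₁) ?_)
    simp only [hf] at h
    linarith
  -- `1 - f (2t) = 2 (1 - f t)(1 + f t) ≥ 2 (1 - f t)`, since `f > 0`. Unbounded growth contradicts
  -- `1 - f < 1`.
  have hgrow : ∀ n : ℕ, (2 : ℝ) ^ n * (1 - f t₁) ≤ 1 - f (2 ^ n * t₁) := by
    intro n
    induction n with
    | zero => simp
    | succ n ih =>
      have h2 : (2 : ℝ) ^ (n + 1) * t₁ = 2 * (2 ^ n * t₁) := by ring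
      rw [h2, hdouble, pow_succ]
      nlinarith [hpos (2 ^ n * t₁), hle (2 ^ n * t₁)]
  obtain ⟨n, hn⟩ := pow_unbounded_of_one_lt (1 / (1 - f t₁)) (one_lt_two : (1 : ℝ) < 2)
  have h1 := hgrow n
  rw [div_lt_iff₀ (by linarith)] at hn
  linarith [hpos (2 ^ n * t₁)]

theorem mul_self_eq_one_of_trace {R : Matrix (Fin 3) (Fin 3) ℝ} (hR : Rᵀ * R = 1)
    (hdet : R.det = 1) (htr : R.trace = -1) : R * R = 1 := by
  refine eq_one_of_orthogonal_of_trace ?_ ?_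
  · rw [transpose_mul, mul_assoc, ← mul_assoc Rᵀ R R, hR, one_mul, hR]
  · rw [trace_mul_self_of_orthogonal hR hdet, htr]; norm_num

theorem oneParameter_exists_period {R : ℝ → Matrix (Fin 3) (Fin 3) ℝ} (h0 : R 0 = 1)
    (hadd : ∀ s t, R (s + t) = R s * R t) (horth : ∀ t, (R t)ᵀ * R t = 1)
    (hdet : ∀ t, (R t).det = 1) (hcont : Continuous fun t => (R t).trace) :
    ∃ T : ℝ, 0 < T ∧ R T = 1 := by
  rcases oneParameter_trivial_or_halfTurn h0 hadd horth hdet hcont with h | ⟨t, ht⟩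
  · exact ⟨1, one_pos, h 1⟩
  · have h2 : R (t + t) = 1 := by
      rw [hadd, mul_self_eq_one_of_trace (horth t) (hdet t) ht]
    have hne : t ≠ 0 := by
      rintro rfl
      rw [h0] at ht
      simp at ht
      norm_num at ht
    rcases lt_or_gt_of_ne hne with hlt | hgt
    · refine ⟨-(t + t), by linarith, ?_⟩
      have := hadd (-(t + t)) (t + t)
      rwa [h2, mul_one, neg_add_cancel, h0, eq_comm] at this
    · exact ⟨t + t, by linarith, h2⟩

/-- A half-turn about the axis spanned by `y` is `2 y yᵀ / |y|² - 1`. -/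
theorem smul_halfTurn_add_one {R : Matrix (Fin 3) (Fin 3) ℝ} (hR : Rᵀ * R = 1)
    (hdet : R.det = 1) (htr : R.trace = -1) {y : Fin 3 → ℝ} (hRy : R *ᵥ y = y) :
    (y ⬝ᵥ y) • (R + 1) = (2 : ℝ) • vecMulVec y y := by
  have hsq := mul_self_eq_one_of_trace hR hdet htr
  have hsymm : Rᵀ = R := by
    calc Rᵀ = Rᵀ * (R * R) := by rw [hsq, mul_one]
      _ = R := by rw [← mul_assoc, hR, one_mul]
  set n := y ⬝ᵥ y with hn_def
  -- `N` is symmetric with `N² = 2n N` and `tr N = n(-1 + 3) - 2n = 0`, so its Frobenius norm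
  -- vanishes.
  set N : Matrix (Fin 3) (Fin 3) ℝ := n • (R + 1) - (2 : ℝ) • vecMulVec y y with hN
  have hNs : Nᵀ = N := by
    rw [hN, transpose_sub, transpose_smul, transpose_smul, transpose_add, hsymm, transpose_one,
      transpose_vecMulVec]
  have hRP : R * vecMulVec y y = vecMulVec y y := by rw [mul_vecMulVec, hRy]
  have hPR : vecMulVec y y * R = vecMulVec y y := by
    rw [vecMulVec_mul, ← mulVec_transpose, hsymm, hRy]
  have hPP : vecMulVec y y * vecMulVec y y = n • vecMulVec y y := by
    rw [vecMulVec_mul_vecMulVec, hn_def, vecMulVec_smul]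
  have hNN : (Nᴴ * N).trace = 0 := by
    rw [conjTranspose_eq_transpose_of_trivial, hNs]
    have : N * N = (2 * n) • N := by
      simp only [hN, sub_mul, mul_sub, smul_mul_assoc, mul_smul_comm, add_mul, mul_add, hRP, hPR,
        hPP, hsq, one_mul, mul_one]
      module
    rw [this, trace_smul, hN, trace_sub, trace_smul, trace_smul, trace_add,
      htr, trace_vecMulVec]
    simp [← hn_def]
    right
    ring
  exact sub_eq_zero.1 (trace_conjTranspose_mul_self_eq_zero_iff.1 hNN)

/-- In odd dimension, `Rᵀ (R - 1) = -(R - 1)ᵀ` gives `det (R - 1) = -det (R - 1)`. -/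
theorem exists_fixed_of_orthogonal {R : Matrix (Fin 3) (Fin 3) ℝ} (hR : Rᵀ * R = 1)
    (hdet : R.det = 1) : ∃ x : Fin 3 → ℝ, x ≠ 0 ∧ R *ᵥ x = x := by
  have h : (R - 1).det = 0 := by
    have h1 : Rᵀ * (R - 1) = -(R - 1)ᵀ := by
      rw [mul_sub, hR, transpose_sub, transpose_one, mul_one, neg_sub]
    have h2 := congrArg det h1
    rw [det_mul, det_transpose, hdet, one_mul, det_neg, det_transpose] at h2
    norm_num at h2
    linarith
  obtain ⟨x, hx, hx'⟩ := exists_mulVec_eq_zero_iff.2 h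
  refine ⟨x, hx, ?_⟩
  rwa [sub_mulVec, one_mulVec, sub_eq_zero] at hx'

end SpecialOrthogonal

/-! ### Invariant inner products by Haar averaging -/

section Averaging

open Matrix MeasureTheory Module

theorem exists_orthonormal_basis_of_pos {V : Type*} [AddCommGroup V] [Module ℝ V]
    [FiniteDimensional ℝ V] {n : ℕ} (hn : finrank ℝ V = n) (B : V →ₗ[ℝ] V →ₗ[ℝ] ℝ)
    (hsymm : ∀ v w, B v w = B w v) (hpos : ∀ v, v ≠ 0 → 0 < B v v) :
    ∃ b : Basis (Fin n) ℝ V, ∀ i j, B (b i) (b j) = (1 : Matrix (Fin n) (Fin n) ℝ) i j := by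
  let c : InnerProductSpace.Core ℝ V :=
    { inner := fun v w => B v w
      conj_inner_symm := fun v w => hsymm w v
      re_inner_nonneg := fun v => by
        by_cases hv : v = 0
        · simp [hv]
        · exact (hpos v hv).le
      add_left := fun u v w => by simp
      smul_left := fun u v r => by simp
      definite := fun v hv => by
        by_contra hne
        exact (hpos v hne).ne' hv }
  let _ : NormedAddCommGroup V := c.toNormedAddCommGroup
  let _ : InnerProductSpace ℝ V := InnerProductSpace.ofCore c.toCore
  let b := (stdOrthonormalBasis ℝ V).reindex (finCongr hn)
  refine ⟨b.toBasis, fun i j => ?_⟩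
  have := orthonormal_iff_ite.1 b.orthonormal i j
  rw [one_apply, ← this, b.coe_toBasis]
  rfl

/-- A finite dimensional continuous representation of a compact group is orthogonal in some
basis. -/
theorem exists_basis_orthogonal {G : Type*} [Group G] [TopologicalSpace G] [IsTopologicalGroup G]
    [T2Space G] [CompactSpace G] {V : Type*} [AddCommGroup V] [Module ℝ V]
    [TopologicalSpace V] [IsTopologicalAddGroup V] [ContinuousSMul ℝ V] [T2Space V]
    [FiniteDimensional ℝ V] {n : ℕ} (hn : finrank ℝ V = n) (ρ : G →* Module.End ℝ V)
    (hρ : ∀ v, Continuous fun g => ρ g v) :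
    ∃ b : Basis (Fin n) ℝ V,
      ∀ g, (LinearMap.toMatrix b b (ρ g))ᵀ * LinearMap.toMatrix b b (ρ g) = 1 := by
  borelize G
  let μ : Measure G := Measure.haar
  let e := finBasis ℝ V
  -- With `g⁻¹` here, applying `ρ h` to both arguments becomes the left translation `g ↦ h⁻¹ g`,
  -- which preserves Haar measure.
  let F : V → V → G → ℝ := fun v w g => ∑ i, e.repr (ρ g⁻¹ v) i * e.repr (ρ g⁻¹ w) i
  have hcoord : ∀ i v, Continuous fun g => e.repr (ρ g v) i := fun i v =>
    (e.coord i).continuous_of_finiteDimensional.comp (hρ v)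
  have hF : ∀ v w, Continuous (F v w) := fun v w =>
    continuous_finsetSum _ fun i _ => ((hcoord i v).mul (hcoord i w)).comp continuous_inv
  have hint : ∀ v w, Integrable (F v w) μ := fun v w =>
    (hF v w).integrable_of_hasCompactSupport (HasCompactSupport.of_compactSpace _)
  let B : V →ₗ[ℝ] V →ₗ[ℝ] ℝ := LinearMap.mk₂ ℝ (fun v w => ∫ g, F v w g ∂μ)
    (fun v v' w => by
      rw [← integral_add (hint _ _) (hint _ _)]
      congr 1; ext g
      simp [F, add_mul, Finset.sum_add_distrib])
    (fun r v w => by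
      rw [smul_eq_mul, ← integral_const_mul]
      congr 1; ext g
      simp [F, Finset.mul_sum, mul_assoc])
    (fun v w w' => by
      rw [← integral_add (hint _ _) (hint _ _)]
      congr 1; ext g
      simp [F, mul_add, Finset.sum_add_distrib])
    (fun r v w => by
      rw [smul_eq_mul, ← integral_const_mul]
      congr 1; ext g
      simp only [F, map_smul, Finset.mul_sum, Finsupp.smul_apply, smul_eq_mul]
      exact Finset.sum_congr rfl fun i _ => by ring)
  have hB : ∀ v w, B v w = ∫ g, F v w g ∂μ := fun v w => rfl
  have hinv : ∀ h v w, B (ρ h v) (ρ h w) = B v w := by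
    intro h v w
    rw [hB, hB, ← integral_mul_left_eq_self (F v w) h⁻¹]
    simp [F]
  have hsymm : ∀ v w, B v w = B w v := by
    intro v w
    rw [hB, hB]
    simp only [F, mul_comm]
  have hpos : ∀ v, v ≠ 0 → 0 < B v v := by
    intro v hv
    rw [hB]
    have h0 : ∀ g, 0 ≤ F v v g := fun g => Finset.sum_nonneg fun i _ => mul_self_nonneg _
    refine (hF v v).integral_pos_of_hasCompactSupport_nonneg_nonzero
      (HasCompactSupport.of_compactSpace _) h0 (x := 1) fun h => hv ?_
    have h1 := (Finset.sum_eq_zero_iff_of_nonneg fun i _ => mul_self_nonneg _).1 h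
    refine e.repr.injective (Finsupp.ext fun i => ?_)
    have := mul_self_eq_zero.1 (h1 i (Finset.mem_univ i))
    simpa using this
  obtain ⟨b, hb⟩ := exists_orthonormal_basis_of_pos hn B hsymm hpos
  refine ⟨b, fun g => ?_⟩
  have hBr : ∀ v w, B v w = ∑ k, b.repr v k * b.repr w k := fun v w => by
    conv_lhs => rw [← b.sum_repr v, ← b.sum_repr w]
    simp [-Basis.sum_repr, hb, one_apply]
    exact Finset.sum_congr rfl fun k _ => mul_comm _ _
  ext i j
  rw [← hb i j, ← hinv g, hBr]
  simp [mul_apply, LinearMap.toMatrix_apply]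

end Averaging

/-! ### The argument in coordinates, from an orthogonal adjoint representation -/

section OrthogonalAdjoint

open Matrix Module

/-- The adjoint representation and the one-parameter subgroups of a compact Lie group of dimension
three whose Lie algebra has trivial center, in coordinates in which the adjoint representation is
orthogonal. -/
structure OrthogonalAdjoint (G : Type*) [Group G] [TopologicalSpace G] where
  /-- The adjoint representation. -/
  Ad : G →* Matrix (Fin 3) (Fin 3) ℝ
  /-- The one-parameter subgroup with a given velocity. -/
  exp : (Fin 3 → ℝ) → ℝ → G
  continuous_Ad : Continuous Ad
  transpose_mul_self : ∀ g, (Ad g)ᵀ * Ad g = 1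
  exp_add : ∀ v s t, exp v (s + t) = exp v s * exp v t
  continuous_exp : ∀ v, Continuous (exp v)
  exp_smul : ∀ (c : ℝ) v t, exp (c • v) t = exp v (c * t)
  exp_injective : ∀ v w, (∀ t, exp v t = exp w t) → v = w
  conj_exp : ∀ g v t, g * exp v t * g⁻¹ = exp (Ad g *ᵥ v) t
  eq_zero_of_fixed : ∀ v, (∀ g, Ad g *ᵥ v = v) → v = 0
  comm_of_Ad_eq_one : ∀ c, Ad c = 1 → ∀ g, c * g = g * c

namespace OrthogonalAdjoint

variable {G : Type*} [Group G] [TopologicalSpace G] (𝒜 : OrthogonalAdjoint G)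

theorem exp_apply_zero (v : Fin 3 → ℝ) : 𝒜.exp v 0 = 1 := by
  have h := 𝒜.exp_add v 0 0
  rw [add_zero] at h
  exact left_eq_mul.1 h

theorem exp_neg (v : Fin 3 → ℝ) (t : ℝ) : 𝒜.exp v (-t) = (𝒜.exp v t)⁻¹ := by
  rw [eq_inv_iff_mul_eq_one, ← 𝒜.exp_add, neg_add_cancel, 𝒜.exp_apply_zero]

theorem eq_zero_of_exp_eq_one {v : Fin 3 → ℝ} (h : ∀ t, 𝒜.exp v t = 1) : v = 0 :=
  𝒜.exp_injective _ _ fun t => by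
    rw [h, ← zero_smul ℝ v, 𝒜.exp_smul, zero_mul, 𝒜.exp_apply_zero]

/-- `exp v t` is the square of `exp v (t / 2)`, and an orthogonal determinant squares to `1`. -/
theorem det_Ad_exp (v : Fin 3 → ℝ) (t : ℝ) : (𝒜.Ad (𝒜.exp v t)).det = 1 := by
  have h := congrArg det (𝒜.transpose_mul_self (𝒜.exp v (t / 2)))
  rwa [det_mul, det_transpose, ← det_mul, det_one, ← map_mul, ← 𝒜.exp_add, add_halves] at h

theorem continuous_trace_Ad_exp (v : Fin 3 → ℝ) :
    Continuous fun t => (𝒜.Ad (𝒜.exp v t)).trace :=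
  (𝒜.continuous_Ad.comp (𝒜.continuous_exp v)).matrix_trace

theorem Ad_exp_mulVec (v : Fin 3 → ℝ) (t : ℝ) : 𝒜.Ad (𝒜.exp v t) *ᵥ v = v :=
  𝒜.exp_injective _ _ fun s => by
    rw [← 𝒜.conj_exp, ← 𝒜.exp_add, add_comm, 𝒜.exp_add, mul_inv_cancel_right]

/-- If `Ad` were trivial along `exp y`, that subgroup would be central and `y` would be fixed by
`Ad`. The half-turn found instead has axis `y`, because `Ad (exp y t)` fixes `y`. -/
theorem exists_halfTurn {y : Fin 3 → ℝ} (hy : y ≠ 0) :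
    ∃ n : G, (y ⬝ᵥ y) • (𝒜.Ad n + 1) = (2 : ℝ) • vecMulVec y y := by
  rcases oneParameter_trivial_or_halfTurn (R := fun t => 𝒜.Ad (𝒜.exp y t))
      (by rw [𝒜.exp_apply_zero, map_one]) (fun s t => by rw [𝒜.exp_add, map_mul])
      (fun t => 𝒜.transpose_mul_self _) (𝒜.det_Ad_exp y) (𝒜.continuous_trace_Ad_exp y)
    with h | ⟨t, ht⟩
  · refine absurd (𝒜.eq_zero_of_fixed y fun g => 𝒜.exp_injective _ _ fun t => ?_) hy
    rw [← 𝒜.conj_exp, ← 𝒜.comm_of_Ad_eq_one _ (h t), mul_inv_cancel_right]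
  · exact ⟨𝒜.exp y t, smul_halfTurn_add_one (𝒜.transpose_mul_self _) (𝒜.det_Ad_exp y t) ht
      (𝒜.Ad_exp_mulVec y t)⟩

/-- Every one-parameter subgroup is periodic. -/
theorem exists_exp_eq_one (x : Fin 3 → ℝ) : ∃ T : ℝ, 0 < T ∧ 𝒜.exp x T = 1 := by
  obtain ⟨T, hT, hAd⟩ := oneParameter_exists_period (R := fun t => 𝒜.Ad (𝒜.exp x t))
      (by rw [𝒜.exp_apply_zero, map_one]) (fun s t => by rw [𝒜.exp_add, map_mul])
      (fun t => 𝒜.transpose_mul_self _) (𝒜.det_Ad_exp x) (𝒜.continuous_trace_Ad_exp x)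
  -- A half-turn about `y ⟂ x` reverses `x`, hence inverts the central element `exp x T`, which
  -- conjugation leaves fixed. Its square is therefore `1`.
  obtain ⟨y, hy, hyx⟩ : ∃ y : Fin 3 → ℝ, y ≠ 0 ∧ y ⬝ᵥ x = 0 := by
    by_cases hx : x 0 = 0
    · exact ⟨![1, 0, 0], fun h => one_ne_zero (congrFun h 0), by
        simp [dotProduct, Fin.sum_univ_three, hx]⟩
    · exact ⟨![-x 1, x 0, 0], fun h => hx (congrFun h 1), by
        simp [dotProduct, Fin.sum_univ_three]; ring⟩
  obtain ⟨n, hn⟩ := 𝒜.exists_halfTurn hy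
  have hyy : y ⬝ᵥ y ≠ 0 := fun h => hy (dotProduct_self_eq_zero.1 h)
  have hnx : 𝒜.Ad n *ᵥ x = (-1 : ℝ) • x := by
    have h := congrArg (· *ᵥ x) hn
    simp only [smul_mulVec, add_mulVec, one_mulVec, vecMulVec_mulVec, hyx] at h
    rw [MulOpposite.op_zero, zero_smul, smul_zero] at h
    rw [neg_one_smul]
    exact eq_neg_of_add_eq_zero_left ((smul_eq_zero.1 h).resolve_left hyy)
  refine ⟨T + T, by linarith, ?_⟩
  have h := 𝒜.conj_exp n x T
  rw [← 𝒜.comm_of_Ad_eq_one _ hAd, mul_inv_cancel_right, hnx, 𝒜.exp_smul, neg_one_mul,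
    𝒜.exp_neg] at h
  rw [𝒜.exp_add]
  exact eq_inv_iff_mul_eq_one.1 h

/-- The adjoint representation is absolutely irreducible. -/
theorem subalgebra_eq_top {W : Subalgebra ℝ (Matrix (Fin 3) (Fin 3) ℝ)}
    (hW : ∀ g, 𝒜.Ad g ∈ W) : W = ⊤ := by
  have hsq : ∀ y : Fin 3 → ℝ, vecMulVec y y ∈ W := by
    intro y
    by_cases hy : y = 0
    · rw [hy, vecMulVec_zero]; exact W.zero_mem
    · obtain ⟨n, hn⟩ := 𝒜.exists_halfTurn hy
      have : vecMulVec y y = (2⁻¹ : ℝ) • ((2 : ℝ) • vecMulVec y y) := by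
        rw [smul_smul]; norm_num
      rw [this, ← hn]
      exact W.smul_mem (W.smul_mem (W.add_mem (hW n) W.one_mem) _) _
  have hsingle : ∀ i j, single i j (1 : ℝ) ∈ W := by
    intro i j
    have hE : ∀ i j : Fin 3,
        single i j (1 : ℝ) = vecMulVec (Pi.single i (1 : ℝ)) (Pi.single j (1 : ℝ)) :=
      fun i j => single_eq_single_vecMulVec_single i j
    by_cases hij : i = j
    · rw [hij, hE]; exact hsq _
    -- For `y = eᵢ + eⱼ`, the product `(eᵢ eᵢᵀ)(y yᵀ)(eⱼ eⱼᵀ)` is the matrix unit, as `yᵢ = yⱼ = 1`.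
    · set y : Fin 3 → ℝ := Pi.single i 1 + Pi.single j 1 with hy
      have := W.mul_mem (W.mul_mem (hsq (Pi.single i 1)) (hsq y)) (hsq (Pi.single j 1))
      rw [hE]
      convert this using 1
      simp [vecMulVec_mul_vecMulVec, hy, Ne.symm hij]
  refine eq_top_iff.2 fun M _ => ?_
  rw [matrix_eq_sum_single M]
  refine W.sum_mem fun i _ => W.sum_mem fun j _ => ?_
  have : single i j (M i j) = M i j • single i j (1 : ℝ) := by simp
  rw [this]
  exact W.smul_mem (hsingle i j) _

theorem eq_scalar_of_commute {S : Matrix (Fin 3) (Fin 3) ℝ} (hS : ∀ g, S * 𝒜.Ad g = 𝒜.Ad g * S) :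
    ∃ c : ℝ, S = c • (1 : Matrix (Fin 3) (Fin 3) ℝ) := by
  have htop : Subalgebra.centralizer ℝ {S} = ⊤ := 𝒜.subalgebra_eq_top fun g => by
    rw [Subalgebra.mem_centralizer_iff]
    rintro _ rfl
    exact hS g
  obtain ⟨c, hc⟩ := mem_range_scalar_of_commute_single (M := S) fun i j _ => by
    have h : single i j (1 : ℝ) ∈ Subalgebra.centralizer ℝ {S} := htop ▸ Algebra.mem_top
    exact (Subalgebra.mem_centralizer_iff ℝ |>.1 h S rfl).symm
  exact ⟨c, by rw [← hc, smul_one_eq_diagonal]; rfl⟩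

/-- The periods of `exp x` form a closed subgroup of `ℝ`, containing some `T > 0` and stable under
`μ` and `μ⁻¹`. If one of these factors were below `1`, its powers times `T` would make the subgroup
dense, hence all of `ℝ`, and `x` would be `0`. -/
theorem eq_one_of_scale_period [T2Space G] {x : Fin 3 → ℝ} (hx : x ≠ 0) {μ : ℝ} (hμ : 0 < μ)
    (h : ∀ s, 𝒜.exp x (μ * s) = 1 ↔ 𝒜.exp x s = 1) : μ = 1 := by
  have key : ∀ ν : ℝ, 0 < ν → (∀ s, 𝒜.exp x s = 1 → 𝒜.exp x (ν * s) = 1) → ¬ν < 1 := by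
    intro ν hν hs hlt
    let P : AddSubgroup ℝ :=
      { carrier := {s | 𝒜.exp x s = 1}
        add_mem' := fun {a b} ha hb => by
          rw [Set.mem_ofPred_eq] at *
          rw [𝒜.exp_add, ha, hb, one_mul]
        zero_mem' := 𝒜.exp_apply_zero x
        neg_mem' := fun {a} ha => by
          rw [Set.mem_ofPred_eq] at *
          rw [𝒜.exp_neg, ha, inv_one] }
    have hclosed : IsClosed (P : Set ℝ) :=
      isClosed_singleton.preimage (𝒜.continuous_exp x)
    obtain ⟨T, hT, hT1⟩ := 𝒜.exists_exp_eq_one x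
    have hpow : ∀ n : ℕ, 𝒜.exp x (ν ^ n * T) = 1 := by
      intro n
      induction n with
      | zero => simpa using hT1
      | succ n ih =>
        rw [pow_succ', mul_assoc]
        exact hs _ ih
    have hdense : Dense (P : Set ℝ) := AddSubgroup.dense_of_not_isolated_zero P fun ε hε => by
      obtain ⟨n, hn⟩ := exists_pow_lt_of_lt_one (div_pos hε hT) hlt
      exact ⟨ν ^ n * T, hpow n, by positivity, (lt_div_iff₀ hT).1 hn⟩
    refine hx (𝒜.eq_zero_of_exp_eq_one fun t => ?_)
    have : t ∈ (P : Set ℝ) := by rw [← hclosed.closure_eq, hdense.closure_eq]; trivial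
    exact this
  have h1 := key μ hμ fun s hs => (h s).2 hs
  have h2 := key μ⁻¹ (inv_pos.2 hμ) fun s hs => (h _).1 (by rwa [mul_inv_cancel_left₀ hμ.ne'])
  rw [inv_lt_one₀ hμ] at h2
  exact le_antisymm (not_lt.1 h2) (not_lt.1 h1)

section Automorphism

variable {f : G ≃* G} {D : Matrix (Fin 3) (Fin 3) ℝ}

/-- Both sides describe the image under `f` of `g (exp v) g⁻¹`. -/
theorem mul_Ad_of_automorphism (hf : ∀ v s, f (𝒜.exp v s) = 𝒜.exp (D *ᵥ v) s) (g : G) :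
    D * 𝒜.Ad g = 𝒜.Ad (f g) * D := by
  refine Matrix.ext_of_mulVec_single fun i => 𝒜.exp_injective _ _ fun t => ?_
  rw [← mulVec_mulVec, ← mulVec_mulVec, ← hf, ← 𝒜.conj_exp, ← 𝒜.conj_exp, ← hf, map_mul, map_mul,
    map_inv]

/-- The differential of an automorphism is a rotation if it has positive determinant. -/
theorem automorphism_orthogonal [T2Space G] (hf : ∀ v s, f (𝒜.exp v s) = 𝒜.exp (D *ᵥ v) s)
    (hdet : 0 < D.det) : Dᵀ * D = 1 := by
  have hcomm : ∀ g, Dᵀ * D * 𝒜.Ad g = 𝒜.Ad g * (Dᵀ * D) := by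
    intro g
    have h1 := 𝒜.mul_Ad_of_automorphism hf g
    have h2 := congrArg transpose (𝒜.mul_Ad_of_automorphism hf g)
    rw [transpose_mul, transpose_mul] at h2
    have h3 : 𝒜.Ad g * (𝒜.Ad g)ᵀ = 1 := mul_eq_one_comm.1 (𝒜.transpose_mul_self g)
    calc Dᵀ * D * 𝒜.Ad g = 𝒜.Ad g * ((𝒜.Ad g)ᵀ * Dᵀ) * (D * 𝒜.Ad g) := by
          rw [← mul_assoc (𝒜.Ad g), h3, one_mul, mul_assoc]
      _ = 𝒜.Ad g * (Dᵀ * ((𝒜.Ad (f g))ᵀ * 𝒜.Ad (f g)) * D) := by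
          rw [h2, h1]; simp only [mul_assoc]
      _ = 𝒜.Ad g * (Dᵀ * D) := by rw [𝒜.transpose_mul_self, mul_one]
  obtain ⟨c, hc⟩ := 𝒜.eq_scalar_of_commute hcomm
  have hc3 : c ^ 3 = D.det ^ 2 := by
    have h := congrArg det hc
    rw [det_mul, det_transpose, det_smul, det_one, Fintype.card_fin, mul_one] at h
    rw [← h, sq]
  have hc0 : 0 < c := by
    have : 0 < c ^ 3 := hc3 ▸ pow_pos hdet 2
    exact (Odd.pow_pos_iff (by decide)).1 this
  set μ := Real.sqrt c with hμ
  have hμ0 : 0 < μ := Real.sqrt_pos.2 hc0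
  have hμc : μ * μ = c := Real.mul_self_sqrt hc0.le
  have hR : (μ⁻¹ • D)ᵀ * (μ⁻¹ • D) = 1 := by
    rw [transpose_smul, smul_mul_smul_comm, hc, smul_smul, ← hμc]
    rw [show μ⁻¹ * μ⁻¹ * (μ * μ) = 1 by field_simp, one_smul]
  have hRdet : (μ⁻¹ • D).det = 1 := by
    have h := congrArg det hR
    rw [det_mul, det_transpose, det_one] at h
    have hp : 0 < (μ⁻¹ • D).det := by
      rw [det_smul]
      positivity
    nlinarith
  -- On the axis of the rotation `μ⁻¹ D`, the automorphism acts by `exp x s ↦ exp x (μ s)`; being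
  -- injective, it preserves and reflects periods.
  obtain ⟨x, hx0, hx⟩ := exists_fixed_of_orthogonal hR hRdet
  have hDx : D *ᵥ x = μ • x := by
    rw [smul_mulVec, inv_smul_eq_iff₀ hμ0.ne'] at hx
    exact hx
  have hμ1 : μ = 1 := 𝒜.eq_one_of_scale_period hx0 hμ0 fun s => by
    rw [← 𝒜.exp_smul, ← hDx, ← hf, map_eq_one_iff f f.injective]
  rw [hc, ← hμc, hμ1, one_mul, one_smul]

end Automorphism

/-- A flow of automorphisms has a period on the Lie algebra. -/
theorem exists_period_of_flow [T2Space G] {f : ℝ → G ≃* G}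
    {D : ℝ → Matrix (Fin 3) (Fin 3) ℝ} (hD0 : D 0 = 1) (hD : ∀ s t, D (s + t) = D s * D t)
    (hf : ∀ t v s, f t (𝒜.exp v s) = 𝒜.exp (D t *ᵥ v) s)
    (hcont : ∀ g, Continuous fun t => f t g) : ∃ T : ℝ, 0 < T ∧ D T = 1 := by
  have hne : ∀ t, (D t).det ≠ 0 := fun t h => by
    have := congrArg det (hD t (-t))
    rw [det_mul, h, zero_mul, add_neg_cancel, hD0, det_one] at this
    exact one_ne_zero this
  -- `D t` is the square of the invertible matrix `D (t / 2)`.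
  have hpos : ∀ t, 0 < (D t).det := fun t => by
    rw [← add_halves t, hD, det_mul]
    exact mul_self_pos.2 (hne _)
  have horth : ∀ t, (D t)ᵀ * D t = 1 := fun t => 𝒜.automorphism_orthogonal (hf t) (hpos t)
  have horth' : ∀ t, D t * (D t)ᵀ = 1 := fun t => mul_eq_one_comm.1 (horth t)
  have hdet : ∀ t, (D t).det = 1 := fun t => by
    have h := congrArg det (horth t)
    rw [det_mul, det_transpose, det_one] at h
    nlinarith [hpos t]
  -- Continuity of `D` is not assumed, only that of `t ↦ f t g`. It gives continuity of `D t * Ad g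
  -- * (D t)ᵀ = Ad (f t g)`, and irreducibility extends this from `Ad g` to every matrix.
  let W : Subalgebra ℝ (Matrix (Fin 3) (Fin 3) ℝ) :=
    { carrier := {M | Continuous fun t => D t * M * (D t)ᵀ}
      mul_mem' := fun {M N} hM hN => by
        rw [Set.mem_ofPred_eq] at *
        convert hM.mul hN using 2 with t
        rw [Pi.mul_apply, show D t * M * (D t)ᵀ * (D t * N * (D t)ᵀ) =
            D t * M * ((D t)ᵀ * D t) * N * (D t)ᵀ by
          simp only [mul_assoc], horth, mul_one, mul_assoc (D t) M N]
      add_mem' := fun {M N} hM hN => by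
        rw [Set.mem_ofPred_eq] at *
        convert hM.add hN using 2 with t
        rw [mul_add, add_mul, Pi.add_apply]
      algebraMap_mem' := fun c => by
        rw [Set.mem_ofPred_eq]
        convert continuous_const (y := algebraMap ℝ (Matrix (Fin 3) (Fin 3) ℝ) c) using 2 with t
        rw [← Algebra.commutes, mul_assoc, horth', mul_one] }
  have hW : W = ⊤ := 𝒜.subalgebra_eq_top fun g => by
    change Continuous fun t => D t * 𝒜.Ad g * (D t)ᵀ
    convert 𝒜.continuous_Ad.comp (hcont g) using 2 with t
    rw [𝒜.mul_Ad_of_automorphism (hf t), mul_assoc, horth', mul_one, Function.comp_apply]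
  have hentry : ∀ i j, Continuous fun t => D t i j * D t j i := fun i j => by
    have h : single j i (1 : ℝ) ∈ W := hW ▸ Algebra.mem_top
    have h' : Continuous fun t => D t * single j i (1 : ℝ) * (D t)ᵀ := h
    convert h'.matrix_elem i j using 2 with t
    simp [mul_apply, single_apply, ite_and]
  refine oneParameter_exists_period hD0 hD horth hdet ?_
  -- Conjugation by `D` only controls products of two entries; these suffice because `tr (D t) = tr
  -- (D (t / 2) ^ 2)`.
  have htr : Continuous fun t => (D t * D t).trace := by
    simp only [trace, diag_apply, mul_apply]
    exact continuous_finsetSum _ fun i _ => continuous_finsetSum _ fun j _ => hentry i j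
  convert htr.comp (continuous_id.div_const (2 : ℝ)) using 2 with t
  rw [Function.comp_apply, ← hD, id, add_halves]

end OrthogonalAdjoint
end OrthogonalAdjoint

/-! ### Bi-invariant fields are central -/

section LieBracket

open VectorField Filter
open scoped Topology

/-- In a local group law `m`, the field of left translates of `w` commutes with the field of left
translates of `v` if the latter is also the field of right translates of `v`. -/
theorem lieBracket_eq_zero_of_partial {E : Type*} [NormedAddCommGroup E] [NormedSpace ℝ E]
    {m : E × E → E} {x₀ v w : E} (hm : ContDiffAt ℝ 2 m (x₀, x₀))
    (hl : ∀ᶠ x in 𝓝 x₀, m (x₀, x) = x) (hr : ∀ᶠ x in 𝓝 x₀, m (x, x₀) = x) {V W : E → E}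
    (hV : ∀ᶠ x in 𝓝 x₀, V x = fderiv ℝ (fun y => m (y, x)) x₀ v)
    (hW : ∀ᶠ x in 𝓝 x₀, W x = fderiv ℝ (fun y => m (x, y)) x₀ w) :
    lieBracketWithin ℝ V W Set.univ x₀ = 0 := by
  have hm1 : ∀ᶠ p in 𝓝 (x₀, x₀), DifferentiableAt ℝ m p :=
    (hm.eventually (by simp)).mono fun p hp => hp.differentiableAt (by norm_num)
  have hd : DifferentiableAt ℝ (fderiv ℝ m) (x₀, x₀) :=
    (hm.fderiv_right (m := 1) (by norm_num)).differentiableAt (by norm_num)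
  have hil : Tendsto (fun x : E => (x, x₀)) (𝓝 x₀) (𝓝 (x₀, x₀)) := by
    exact (Continuous.prodMk continuous_id continuous_const).tendsto x₀
  have hir : Tendsto (fun x : E => (x₀, x)) (𝓝 x₀) (𝓝 (x₀, x₀)) := by
    exact (Continuous.prodMk continuous_const continuous_id).tendsto x₀
  have hW' : W =ᶠ[𝓝 x₀] fun x => fderiv ℝ m (x, x₀) (0, w) := by
    filter_upwards [hW, hil.eventually hm1] with x hx hdx
    have h : HasFDerivAt (fun y => m (x, y))
        ((fderiv ℝ m (x, x₀)).comp (ContinuousLinearMap.inr ℝ E E)) x₀ :=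
      hdx.hasFDerivAt.comp x₀ (hasFDerivAt_prodMk_right x x₀)
    rw [hx, h.fderiv]
    rfl
  have hV' : V =ᶠ[𝓝 x₀] fun x => fderiv ℝ m (x₀, x) (v, 0) := by
    filter_upwards [hV, hir.eventually hm1] with x hx hdx
    have h : HasFDerivAt (fun y => m (y, x))
        ((fderiv ℝ m (x₀, x)).comp (ContinuousLinearMap.inl ℝ E E)) x₀ :=
      hdx.hasFDerivAt.comp x₀ (hasFDerivAt_prodMk_left x₀ x)
    rw [hx, h.fderiv]
    rfl
  have hW₀ : W x₀ = w := by
    have h : (fun y => m (x₀, y)) =ᶠ[𝓝 x₀] id := hl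
    rw [hW.self_of_nhds, h.fderiv_eq, fderiv_id]
    rfl
  have hV₀ : V x₀ = v := by
    have h : (fun y => m (y, x₀)) =ᶠ[𝓝 x₀] id := hr
    rw [hV.self_of_nhds, h.fderiv_eq, fderiv_id]
    rfl
  have hWd : fderiv ℝ W x₀ v = fderiv ℝ (fderiv ℝ m) (x₀, x₀) (v, 0) (0, w) := by
    have h : HasFDerivAt (fun x => fderiv ℝ m (x, x₀))
        ((fderiv ℝ (fderiv ℝ m) (x₀, x₀)).comp (ContinuousLinearMap.inl ℝ E E)) x₀ :=
      HasFDerivAt.comp (f := fun x => (x, x₀)) x₀ hd.hasFDerivAt (hasFDerivAt_prodMk_left x₀ x₀)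
    rw [hW'.fderiv_eq, (h.clm_apply (hasFDerivAt_const (0, w) x₀)).fderiv]
    simp
  have hVd : fderiv ℝ V x₀ w = fderiv ℝ (fderiv ℝ m) (x₀, x₀) (0, w) (v, 0) := by
    have h : HasFDerivAt (fun x => fderiv ℝ m (x₀, x))
        ((fderiv ℝ (fderiv ℝ m) (x₀, x₀)).comp (ContinuousLinearMap.inr ℝ E E)) x₀ :=
      hd.hasFDerivAt.comp x₀ (hasFDerivAt_prodMk_right x₀ x₀)
    rw [hV'.fderiv_eq, (h.clm_apply (hasFDerivAt_const (v, 0) x₀)).fderiv]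
    simp
  -- The two terms of the bracket are the same mixed second derivative of the group law, taken in
  -- opposite orders.
  have hsymm := (hm.isSymmSndFDerivAt (by simp)).eq (v, 0) (0, w)
  rw [lieBracketWithin_univ, lieBracket_eq]
  simp only [hV₀, hW₀, hWd, hVd, hsymm, sub_self]

variable {E : Type*} [NormedAddCommGroup E] [NormedSpace ℝ E]
  {H : Type*} [TopologicalSpace H] {I : ModelWithCorners ℝ E H}
  {G : Type*} [TopologicalSpace G] [ChartedSpace H G] [Group G] [LieGroup I ∞ G]

/-- Applied to a translation `f` carrying `1` to `y`, this turns the chart expression of an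
invariant field into a partial derivative of the local group law. -/
theorem mfderiv_extChartAt_mfderiv [I.Boundaryless] {M : Type*} [TopologicalSpace M]
    [ChartedSpace H M] [IsManifold I 1 M] {f : M → M} {x y : M} (hf : MDifferentiableAt I I f x) (hfx : f x = y)
    (hy : y ∈ (extChartAt I x).source) (v : TangentSpace I x) :
    mfderiv I 𝓘(ℝ, E) (extChartAt I x) y (mfderiv I I f x v : TangentSpace I (f x)) =
      fderiv ℝ (fun z => extChartAt I x (f ((extChartAt I x).symm z))) (extChartAt I x x) v := by
  have h1 : MDifferentiableAt I 𝓘(ℝ, E) (extChartAt I x) y :=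
    mdifferentiableAt_extChartAt (by rwa [extChartAt_source] at hy)
  have h2 : MDifferentiableAt I 𝓘(ℝ, E) (extChartAt I x ∘ f) x := h1.comp_of_eq x hf hfx
  have h3 : MDifferentiableAt 𝓘(ℝ, E) I (extChartAt I x).symm (extChartAt I x x) := by
    have := mdifferentiableWithinAt_extChartAt_symm (I := I) (mem_extChartAt_target (I := I) x)
    rwa [I.range_eq_univ, mdifferentiableWithinAt_univ] at this
  have h4 : mfderiv 𝓘(ℝ, E) I (extChartAt I x).symm (extChartAt I x x) v = v := by
    have := mfderivWithin_range_extChartAt_symm (I := I) (x := x)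
    rw [I.range_eq_univ, mfderivWithin_univ] at this
    rw [this]
    rfl
  have h5 := mfderiv_comp_apply_of_eq (I := 𝓘(ℝ, E)) (g := extChartAt I x ∘ f) _ h2 h3
    (extChartAt_to_inv x) v
  rw [mfderiv_eq_fderiv, h4] at h5
  rw [← mfderiv_comp_apply_of_eq x h1 hf hfx]
  exact h5.symm

theorem mpullbackWithin_extChartAt_symm_eq {M : Type*} [TopologicalSpace M] [ChartedSpace H M]
    [IsManifold I 1 M] (V : (x : M) → TangentSpace I x) {x : M} {y : E}
    (hy : y ∈ (extChartAt I x).target) :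
    mpullbackWithin 𝓘(ℝ, E) I (extChartAt I x).symm V (Set.range I) y =
      mfderiv I 𝓘(ℝ, E) (extChartAt I x) ((extChartAt I x).symm y)
        (V ((extChartAt I x).symm y)) := by
  rw [mpullbackWithin_apply, ContinuousLinearMap.inverse_eq
    (mfderivWithin_extChartAt_symm_comp_mfderiv_extChartAt hy)
    (mfderiv_extChartAt_comp_mfderivWithin_extChartAt_symm hy)]
  rfl

variable {G : Type*} [TopologicalSpace G] [ChartedSpace H G] [Group G] [LieGroup I ∞ G]
  [I.Boundaryless]

theorem contDiffAt_extChartAt_mul :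
    ContDiffAt ℝ ∞ (fun p : E × E => extChartAt I (1 : G)
      ((extChartAt I (1 : G)).symm p.1 * (extChartAt I (1 : G)).symm p.2))
      (extChartAt I (1 : G) 1, extChartAt I (1 : G) 1) := by
  have hs : ContMDiffAt 𝓘(ℝ, E) I ∞ (extChartAt I (1 : G)).symm (extChartAt I (1 : G) 1) :=
    (contMDiffOn_extChartAt_symm (1 : G)).contMDiffAt (extChartAt_target_mem_nhds (1 : G))
  have h1 : ContMDiffAt 𝓘(ℝ, E × E) I ∞
      (fun p : E × E => (extChartAt I (1 : G)).symm p.1)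
      (extChartAt I (1 : G) 1, extChartAt I (1 : G) 1) :=
    ContMDiffAt.comp (I' := 𝓘(ℝ, E)) (f := Prod.fst)
      (extChartAt I (1 : G) 1, extChartAt I (1 : G) 1) hs contDiffAt_fst.contMDiffAt
  have h2 : ContMDiffAt 𝓘(ℝ, E × E) I ∞
      (fun p : E × E => (extChartAt I (1 : G)).symm p.2)
      (extChartAt I (1 : G) 1, extChartAt I (1 : G) 1) :=
    ContMDiffAt.comp (I' := 𝓘(ℝ, E)) (f := Prod.snd)
      (extChartAt I (1 : G) 1, extChartAt I (1 : G) 1) hs contDiffAt_snd.contMDiffAt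
  have h3 := h1.mul h2
  have he : ContMDiffAt I 𝓘(ℝ, E) ∞ (extChartAt I (1 : G)) 1 := contMDiffAt_extChartAt
  exact (he.comp_of_eq h3 (by simp)).contDiffAt

/-- Left and right translations commute. By `hv` the field of `v` can be differentiated in the first
factor of the product, while that of `w` is differentiated in the second. -/
theorem mlieBracket_eq_zero_of_biinvariant {v : GroupLieAlgebra I G}
    (hv : ∀ g, mulInvariantVectorField v g = rightInvariantVectorField I v g)
    (w : GroupLieAlgebra I G) : ⁅v, w⁆ = 0 := by
  have : IsManifold I 1 G := IsManifold.of_le (n := ∞) (by simp)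
  rw [GroupLieAlgebra.bracket_def, mlieBracket, mlieBracketWithin_apply]
  set e := extChartAt I (1 : G) with he
  have htarget : ∀ᶠ x in 𝓝 (e 1), x ∈ e.target := extChartAt_target_mem_nhds (1 : G)
  have hinv : e.symm (e 1) = 1 := extChartAt_to_inv (1 : G)
  have key := lieBracket_eq_zero_of_partial (E := E) (v := v) (w := w)
    (V := mpullbackWithin 𝓘(ℝ, E) I e.symm (mulInvariantVectorField v) (Set.range I))
    (W := mpullbackWithin 𝓘(ℝ, E) I e.symm (mulInvariantVectorField w) (Set.range I))
    ((contDiffAt_extChartAt_mul (I := I) (G := G)).of_le (by norm_cast))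
    (htarget.mono fun x hx => by simp only [← he, hinv, one_mul, e.right_inv hx])
    (htarget.mono fun x hx => by simp only [← he, hinv, mul_one, e.right_inv hx])
    (htarget.mono fun x hx => by
      rw [mpullbackWithin_extChartAt_symm_eq _ hx, hv]
      exact mfderiv_extChartAt_mfderiv
        ((contMDiff_mul_right (I := I) (n := ∞)).mdifferentiable (by simp) _) (one_mul _)
        (e.map_target hx) v)
    (htarget.mono fun x hx => by
      rw [mpullbackWithin_extChartAt_symm_eq _ hx]
      exact mfderiv_extChartAt_mfderiv
        ((contMDiff_mul_left (I := I) (n := ∞)).mdifferentiable (by simp) _) (mul_one _)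
        (e.map_target hx) w)
  rw [Set.preimage_univ, Set.univ_inter, I.range_eq_univ]
  rw [I.range_eq_univ] at key
  exact (congrArg _ key).trans (map_zero _)

end LieBracket

/-! ### Invariant fields, one-parameter subgroups and the exponential -/

section OneParameterSubgroup

open Set

theorem IsMIntegralCurveOn.comp_of_related {E : Type*} [NormedAddCommGroup E] [NormedSpace ℝ E]
    {H : Type*} [TopologicalSpace H] {I : ModelWithCorners ℝ E H}
    {M : Type*} [TopologicalSpace M] [ChartedSpace H M] {γ : ℝ → M} {s : Set ℝ}
    {V W : (x : M) → TangentSpace I x} {f : M → M} (hf : MDifferentiable I I f)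
    (hVW : ∀ x, mfderiv I I f x (V x) = W (f x)) (hγ : IsMIntegralCurveOn (I := I) γ V s) :
    IsMIntegralCurveOn (I := I) (fun t => f (γ t)) W s := by
  intro t ht
  have h := (hf (γ t)).hasMFDerivAt.comp_hasMFDerivWithinAt t (hγ t ht)
  have he : (mfderiv I I f (γ t)).comp ((1 : ℝ →L[ℝ] ℝ).smulRight (V (γ t))) =
      (1 : ℝ →L[ℝ] ℝ).smulRight (W (f (γ t))) := by
    ext
    simp [← hVW]
  exact h.congr_mfderiv he

theorem IsMIntegralCurve.comp_of_related {E : Type*} [NormedAddCommGroup E] [NormedSpace ℝ E]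
    {H : Type*} [TopologicalSpace H] {I : ModelWithCorners ℝ E H}
    {M : Type*} [TopologicalSpace M] [ChartedSpace H M] {γ : ℝ → M}
    {V W : (x : M) → TangentSpace I x} {f : M → M} (hf : MDifferentiable I I f)
    (hVW : ∀ x, mfderiv I I f x (V x) = W (f x)) (hγ : IsMIntegralCurve (I := I) γ V) :
    IsMIntegralCurve (I := I) (fun t => f (γ t)) W := by
  rw [isMIntegralCurve_iff_isMIntegralCurveOn] at *
  exact hγ.comp_of_related hf hVW

variable {E : Type*} [NormedAddCommGroup E] [NormedSpace ℝ E]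
  {H : Type*} [TopologicalSpace H] {I : ModelWithCorners ℝ E H}
  {G : Type*} [TopologicalSpace G] [ChartedSpace H G] [Group G]

theorem rightInvariantVectorField_one (v : GroupLieAlgebra I G) :
    rightInvariantVectorField I v 1 = v := by
  have h : (fun x : G => x * 1) = id := by ext; simp
  unfold rightInvariantVectorField
  rw [h, mfderiv_id]
  rfl

theorem rightInvariantVectorField_smul (c : ℝ) (v : GroupLieAlgebra I G) (g : G) :
    rightInvariantVectorField I (c • v) g = c • rightInvariantVectorField I v g :=
  map_smul (mfderiv I I (fun x : G => x * g) 1) c v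

variable [LieGroup I ∞ G]

theorem mdifferentiable_mul_right_const (g : G) : MDifferentiable I I (fun x : G => x * g) :=
  (contMDiff_mul_right (I := I) (n := ∞)).mdifferentiable (by simp)

theorem mfderiv_mul_right_rightInvariantVectorField (v : GroupLieAlgebra I G) (g h : G) :
    mfderiv I I (fun x => x * h) g (rightInvariantVectorField I v g) =
      rightInvariantVectorField I v (g * h) := by
  have h1 := mfderiv_comp_apply_of_eq (I := I) (I' := I) (I'' := I) (f := fun x : G => x * g)
    (g := fun x : G => x * h) 1 (mdifferentiable_mul_right_const h g)
    (mdifferentiable_mul_right_const g 1) (one_mul g) v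
  have h2 : (fun x : G => x * h) ∘ (fun x : G => x * g) = fun x => x * (g * h) := by
    ext; simp [mul_assoc]
  rw [h2] at h1
  exact h1.symm

/-- The field is the tangent map of multiplication applied to `(v, 0_g)`. -/
theorem contMDiff_rightInvariantVectorField (v : GroupLieAlgebra I G) :
    ContMDiff I I.tangent 1
      (fun g : G => (⟨g, rightInvariantVectorField I v g⟩ : TangentBundle I G)) := by
  have : IsManifold I 1 G := IsManifold.of_le (n := ∞) (by simp)
  let fg : G → TangentBundle I G := fun g ↦ Bundle.TotalSpace.mk' E g 0
  have sfg : ContMDiff I I.tangent 1 fg := Bundle.contMDiff_zeroSection _ _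
  let fv : G → TangentBundle I G := fun _ ↦ Bundle.TotalSpace.mk' E 1 v
  have sfv : ContMDiff I I.tangent 1 fv := contMDiff_const
  let F₁ : G → (TangentBundle I G × TangentBundle I G) := fun g ↦ (fv g, fg g)
  have S₁ : ContMDiff I (I.tangent.prod I.tangent) 1 F₁ := sfv.prodMk sfg
  let F₂ : (TangentBundle I G × TangentBundle I G) → TangentBundle (I.prod I) (G × G) :=
    (equivTangentBundleProd I G I G).symm
  have S₂ : ContMDiff (I.tangent.prod I.tangent) (I.prod I).tangent 1 F₂ :=
    contMDiff_equivTangentBundleProd_symm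
  let F₃ : TangentBundle (I.prod I) (G × G) → TangentBundle I G :=
    tangentMap (I.prod I) I (fun (p : G × G) ↦ p.1 * p.2)
  have S₃ : ContMDiff (I.prod I).tangent I.tangent 1 F₃ :=
    ContMDiff.contMDiff_tangentMap (n := ∞) (contMDiff_mul I ∞) (by norm_cast)
  let S := (S₃.comp S₂).comp S₁
  convert! S with g
  · simp [F₁, F₂, F₃, fg, fv]
  · simp only [Function.comp_apply, tangentMap, F₃, F₂, F₁, fg, fv]
    rw [mfderiv_prod_eq_add_apply ((contMDiff_mul I ∞).mdifferentiableAt (by simp))]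
    exact ((congrArg _ (map_zero _)).trans (add_zero _)).symm

theorem isMIntegralCurve_mul_right {v : GroupLieAlgebra I G} {γ : ℝ → G}
    (hγ : IsMIntegralCurve (I := I) γ (rightInvariantVectorField I v)) (g : G) :
    IsMIntegralCurve (I := I) (fun t => γ t * g) (rightInvariantVectorField I v) :=
  hγ.comp_of_related (mdifferentiable_mul_right_const g) fun x =>
    mfderiv_mul_right_rightInvariantVectorField v x g

variable [I.Boundaryless] [T2Space G]

theorem isMIntegralCurve_unique {V : (g : G) → TangentSpace I g}
    (hV : ContMDiff I I.tangent 1 (fun g : G => (⟨g, V g⟩ : TangentBundle I G)))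
    {γ γ' : ℝ → G} (hγ : IsMIntegralCurve (I := I) γ V) (hγ' : IsMIntegralCurve (I := I) γ' V)
    {t₀ : ℝ} (h : γ t₀ = γ' t₀) : γ = γ' :=
  have : IsManifold I 1 G := IsManifold.of_le (n := ∞) (by simp)
  isMIntegralCurve_Ioo_eq_of_contMDiff_boundaryless hV hγ hγ' h

variable [CompleteSpace E]

theorem exists_isMIntegralCurve_rightInvariantVectorField (v : GroupLieAlgebra I G) :
    ∃ γ : ℝ → G, γ 0 = 1 ∧ IsMIntegralCurve (I := I) γ (rightInvariantVectorField I v) := by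
  have : IsManifold I 1 G := IsManifold.of_le (n := ∞) (by simp)
  have hv := contMDiff_rightInvariantVectorField v
  obtain ⟨γ, h0, hγ⟩ := exists_isMIntegralCurveAt_of_contMDiffAt_boundaryless (t₀ := 0)
    (hv.contMDiffAt (x := 1))
  obtain ⟨ε, hε, hγ⟩ := isMIntegralCurveAt_iff'.1 hγ
  rw [Real.ball_eq_Ioo, zero_sub, zero_add] at hγ
  -- Right translates of one local curve give the same existence time `ε` at every point, hence
  -- completeness.
  exact exists_isMIntegralCurve_of_isMIntegralCurveOn hv hε
    (fun g => ⟨fun t => γ t * g, by simp [h0],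
      hγ.comp_of_related (mdifferentiable_mul_right_const g) fun x =>
        mfderiv_mul_right_rightInvariantVectorField v x g⟩) 1

/-- Uniqueness of integral curves makes the choice in `lieGroupExp` immaterial; rescaling time by
`t` does the rest. -/
theorem lieGroupExp_smul_eq {v : GroupLieAlgebra I G} {γ : ℝ → G} (h0 : γ 0 = 1)
    (hγ : IsMIntegralCurve (I := I) γ (rightInvariantVectorField I v)) (t : ℝ) :
    lieGroupExp I (t • v) = γ t := by
  have hex := exists_isMIntegralCurve_rightInvariantVectorField (t • v)
  have hspec := Classical.epsilon_spec hex
  have hscale : IsMIntegralCurve (I := I) (γ ∘ (· * t)) (rightInvariantVectorField I (t • v)) := by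
    convert hγ.comp_mul t using 1
    ext g
    exact rightInvariantVectorField_smul t v g
  have := isMIntegralCurve_unique (contMDiff_rightInvariantVectorField (t • v)) hspec.2 hscale
    (t₀ := 0) (by rw [hspec.1, Function.comp_apply, zero_mul, h0])
  exact (congrFun this 1).trans (by simp)

theorem isMIntegralCurve_lieGroupExp (v : GroupLieAlgebra I G) :
    IsMIntegralCurve (I := I) (fun t : ℝ => lieGroupExp I (t • v))
      (rightInvariantVectorField I v) := by
  obtain ⟨γ, h0, hγ⟩ := exists_isMIntegralCurve_rightInvariantVectorField v
  have : (fun t : ℝ => lieGroupExp I (t • v)) = γ := funext fun t => lieGroupExp_smul_eq h0 hγ t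
  rwa [this]

theorem lieGroupExp_zero : lieGroupExp I (0 : GroupLieAlgebra I G) = 1 := by
  obtain ⟨γ, h0, hγ⟩ := exists_isMIntegralCurve_rightInvariantVectorField (0 : GroupLieAlgebra I G)
  rw [← h0, ← lieGroupExp_smul_eq h0 hγ, smul_zero]
  rfl

theorem lieGroupExp_add_smul (v : GroupLieAlgebra I G) (s t : ℝ) :
    lieGroupExp I ((s + t) • v) = lieGroupExp I (s • v) * lieGroupExp I (t • v) := by
  have h := isMIntegralCurve_lieGroupExp v
  have := isMIntegralCurve_unique (contMDiff_rightInvariantVectorField v) (h.comp_add t)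
    (isMIntegralCurve_mul_right h (lieGroupExp I (t • v))) (t₀ := 0)
    (by simp [lieGroupExp_zero])
  exact congrFun this s

/-- The right invariant vector field given by `v` has the flow `g ↦ exp (t v) g`. -/
theorem isFlowOf_lieGroupExp (v : GroupLieAlgebra I G) :
    IsFlowOf I (rightInvariantVectorField I v) (fun t g => lieGroupExp I (t • v) * g) where
  map_zero g := by rw [zero_smul, lieGroupExp_zero, one_mul]
  isMIntegralCurve g := isMIntegralCurve_mul_right (isMIntegralCurve_lieGroupExp v) g

theorem lieGroupExp_injective {v w : GroupLieAlgebra I G}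
    (h : ∀ t : ℝ, lieGroupExp I (t • v) = lieGroupExp I (t • w)) : v = w := by
  have hv := isMIntegralCurve_lieGroupExp v 0
  have hw := isMIntegralCurve_lieGroupExp w 0
  rw [← funext h] at hw
  have he := congrArg (fun L => L 1) (hasMFDerivAt_unique hv hw)
  have h1 : ∀ u : GroupLieAlgebra I G, ∀ g : G, g = 1 →
      (rightInvariantVectorField I u g : E) = u := by
    rintro u _ rfl
    exact rightInvariantVectorField_one u
  have h0 : lieGroupExp I ((0 : ℝ) • v) = 1 := by rw [zero_smul, lieGroupExp_zero]
  have h2 : (rightInvariantVectorField I v (lieGroupExp I ((0 : ℝ) • v)) : E) =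
      rightInvariantVectorField I w (lieGroupExp I ((0 : ℝ) • v)) :=
    (one_smul ℝ _).symm.trans (he.trans (one_smul ℝ _))
  exact (h1 v _ h0).symm.trans (h2.trans (h1 w _ h0))

end OneParameterSubgroup

/-! ### Maps with zero differential on a connected manifold -/

section LocallyConstant

open Filter
open scoped Topology

theorem eq_of_hasMFDerivAt_zero {E : Type*} [NormedAddCommGroup E] [NormedSpace ℝ E]
    {H : Type*} [TopologicalSpace H] {I : ModelWithCorners ℝ E H} [I.Boundaryless]
    {M : Type*} [TopologicalSpace M] [ChartedSpace H M] [IsManifold I 1 M] [PreconnectedSpace M]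
    {E' : Type*} [NormedAddCommGroup E'] [NormedSpace ℝ E']
    {H' : Type*} [TopologicalSpace H'] {I' : ModelWithCorners ℝ E' H'}
    {N : Type*} [TopologicalSpace N] [ChartedSpace H' N] [IsManifold I' 1 N] {k : M → N}
    (hk : ∀ x, HasMFDerivAt I I' k x 0) (x y : M) : k x = k y := by
  have hloc : IsLocallyConstant k := by
    rw [IsLocallyConstant.iff_eventually_eq]
    intro x
    have hopen : ∀ᶠ z in 𝓝 (extChartAt I x x), z ∈ (extChartAt I x).target ∧
        k ((extChartAt I x).symm z) ∈ (extChartAt I' (k x)).source := by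
      refine (show ∀ᶠ z in 𝓝 (extChartAt I x x), z ∈ (extChartAt I x).target from
        extChartAt_target_mem_nhds x).and ?_
      have hc : ContinuousAt (fun z => k ((extChartAt I x).symm z)) (extChartAt I x x) :=
        ContinuousAt.comp_of_eq (hk x).continuousAt (continuousAt_extChartAt_symm x) (by simp)
      refine hc.eventually ?_
      beta_reduce
      rw [extChartAt_to_inv]
      exact extChartAt_source_mem_nhds (k x)
    obtain ⟨ε, hε, hball⟩ := Metric.eventually_nhds_iff_ball.1 hopen
    have hψ : ∀ z ∈ Metric.ball (extChartAt I x x) ε,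
        HasFDerivAt (fun z => extChartAt I' (k x) (k ((extChartAt I x).symm z)))
          (0 : E →L[ℝ] E') z := by
      intro z hz
      obtain ⟨hz1, hz2⟩ := hball z hz
      have h1 := mdifferentiableWithinAt_extChartAt_symm (I := I) hz1
      rw [I.range_eq_univ, mdifferentiableWithinAt_univ] at h1
      have h2 := (mdifferentiableAt_extChartAt (I := I') (x := k x)
        (by rwa [extChartAt_source] at hz2)).hasMFDerivAt
      have h3 := (h2.comp z ((hk _).comp z h1.hasMFDerivAt)).hasFDerivAt
      exact h3.congr_fderiv ((congrArg _ (ContinuousLinearMap.zero_comp _)).trans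
        (ContinuousLinearMap.comp_zero _))
    have hcont : ContinuousAt (extChartAt I x) x := continuousAt_extChartAt x
    filter_upwards [hcont.eventually (Metric.ball_mem_nhds _ hε),
      extChartAt_source_mem_nhds (I := I) x] with y hy hys
    have hconst := (convex_ball (extChartAt I x x) ε).is_const_of_fderivWithin_eq_zero
      (𝕜 := ℝ) (fun z hz => (hψ z hz).differentiableAt.differentiableWithinAt)
      (fun z hz => by
        rw [fderivWithin_of_isOpen Metric.isOpen_ball hz, (hψ z hz).fderiv]) hy
        (Metric.mem_ball_self hε)
    simp only [extChartAt_to_inv, (extChartAt I x).left_inv hys] at hconst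
    have hys' := (hball _ hy).2
    rw [(extChartAt I x).left_inv hys] at hys'
    exact (extChartAt I' (k x)).injOn hys' (mem_extChartAt_source _) hconst
  exact hloc.apply_eq_of_preconnectedSpace x y

end LocallyConstant

/-! ### Differentials of homomorphisms at the identity -/

section LieDifferential

variable {E : Type*} [NormedAddCommGroup E] [NormedSpace ℝ E]
  {H : Type*} [TopologicalSpace H] {I : ModelWithCorners ℝ E H}
  {G : Type*} [TopologicalSpace G] [ChartedSpace H G] [Group G]

variable (I) in
/-- The differential at the identity of a map that fixes the identity. -/
noncomputable def lieDifferential (f : G → G) : GroupLieAlgebra I G →L[ℝ] GroupLieAlgebra I G :=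
  (mfderiv I I f 1 : E →L[ℝ] E)

theorem lieDifferential_id : lieDifferential I (id : G → G) = ContinuousLinearMap.id ℝ _ :=
  mfderiv_id

theorem lieDifferential_comp {f h : G → G} (hf : MDifferentiable I I f)
    (hh : MDifferentiable I I h) (h1 : h 1 = 1) :
    lieDifferential I (f ∘ h) = (lieDifferential I f).comp (lieDifferential I h) := by
  ext v
  exact mfderiv_comp_apply_of_eq 1 (hf 1) (hh 1) h1 v

variable [LieGroup I ∞ G]

theorem mfderiv_rightInvariantVectorField {f : G →* G} (hf : MDifferentiable I I f)
    (v : GroupLieAlgebra I G) (g : G) :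
    mfderiv I I f g (rightInvariantVectorField I v g) =
      rightInvariantVectorField I (lieDifferential I f v) (f g) := by
  have h1 := mfderiv_comp_apply_of_eq (I := I) (I' := I) (I'' := I) (f := fun x : G => x * g)
    (g := f) 1 (hf g) (mdifferentiable_mul_right_const g 1) (one_mul g) v
  have h2 := mfderiv_comp_apply_of_eq (I := I) (I' := I) (I'' := I) (f := f)
    (g := fun x : G => x * f g) 1 (mdifferentiable_mul_right_const (f g) 1) (hf 1) (map_one f) v
  have h3 : f ∘ (fun x : G => x * g) = (fun x : G => x * f g) ∘ f := by
    ext x; simp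
  rw [h3] at h1
  exact h1.symm.trans h2

theorem hasMFDerivAt_zero_of_translation {k : G → G} {g a b : G}
    (hk : ∀ x, k x = a * k (x * g⁻¹) * b) (h1 : HasMFDerivAt I I k 1 0) :
    HasMFDerivAt I I k g 0 := by
  have hA := (mdifferentiable_mul_right_const (I := I) g⁻¹ g).hasMFDerivAt
  have hk1 : HasMFDerivAt I I k (g * g⁻¹) (0 : E →L[ℝ] E) := by
    rw [mul_inv_cancel]; exact h1
  have hB : MDifferentiable I I (fun y : G => a * y * b) :=
    ((contMDiff_mul_right (I := I) (n := ∞)).comp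
      (contMDiff_mul_left (I := I) (n := ∞))).mdifferentiable (by simp)
  have h := (hB _).hasMFDerivAt.comp g (hk1.comp g hA)
  have hk' : (fun y : G => a * y * b) ∘ k ∘ (fun x => x * g⁻¹) = k :=
    funext fun x => (hk x).symm
  rw [hk'] at h
  refine h.congr_mfderiv ?_
  exact (congrArg _ (ContinuousLinearMap.zero_comp _)).trans (ContinuousLinearMap.comp_zero _)

/-- The map `k x = x⁻¹ * f x` has zero differential at `1`. The identity `k y = x⁻¹ * k (y * x⁻¹) *
f x` carries this to every `x`, so `k` is constant by connectedness. -/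
theorem eq_id_of_lieDifferential_eq_id [I.Boundaryless] [PreconnectedSpace G] {f : G →* G}
    (hf : MDifferentiable I I f)
    (hd : lieDifferential I f = ContinuousLinearMap.id ℝ _) (g : G) : f g = g := by
  have : IsManifold I 1 G := IsManifold.of_le (n := ∞) (by simp)
  let F : G × G → G := fun p => p.1⁻¹ * p.2
  have hF : MDifferentiable (I.prod I) I F :=
    (ContMDiff.mul (n := ∞) (contMDiff_fst.inv) contMDiff_snd).mdifferentiable (by simp)
  have hL : ∀ c : G, c = 1 → (mfderiv (I.prod I) I F (1, c) : E × E →L[ℝ] E) =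
      mfderiv (I.prod I) I F (1, 1) := by
    rintro _ rfl; rfl
  have hid : HasMFDerivAt I I (id : G → G) 1 (ContinuousLinearMap.id ℝ E) := hasMFDerivAt_id 1
  have hf1 : HasMFDerivAt I I f 1 (ContinuousLinearMap.id ℝ E) :=
    (hf 1).hasMFDerivAt.congr_mfderiv hd
  have h1 := (hF (1, f 1)).hasMFDerivAt.comp 1 (hid.prodMk hf1)
  have h2 := HasMFDerivAt.comp (f := fun y : G => (id y, id y)) 1 (hF (1, 1)).hasMFDerivAt
    (hid.prodMk hid)
  have hz : HasMFDerivAt I I (fun _ : G => (1 : G)) 1 (0 : E →L[ℝ] E) := hasMFDerivAt_const 1 1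
  have hFid : F ∘ (fun y : G => (id y, id y)) = fun _ => 1 := by ext; simp [F]
  rw [hFid] at h2
  have h0 := hasMFDerivAt_unique h2 hz
  let k : G → G := fun x => x⁻¹ * f x
  have hk1 : HasMFDerivAt I I k 1 (0 : E →L[ℝ] E) :=
    h1.congr_mfderiv ((congrArg (fun L : E × E →L[ℝ] E => L.comp
      ((ContinuousLinearMap.id ℝ E).prod (ContinuousLinearMap.id ℝ E)))
        (hL _ (map_one f))).trans h0)
  have hk : ∀ x, HasMFDerivAt I I k x 0 := fun x =>
    hasMFDerivAt_zero_of_translation (a := x⁻¹) (b := f x)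
      (fun y => by simp [k, mul_assoc]) hk1
  have := eq_of_hasMFDerivAt_zero hk g 1
  simp only [k, map_one, inv_one, one_mul, inv_mul_eq_one] at this
  exact this.symm

theorem map_lieGroupExp [I.Boundaryless] [T2Space G] [CompleteSpace E] {f : G →* G}
    (hf : MDifferentiable I I f) (v : GroupLieAlgebra I G) (t : ℝ) :
    f (lieGroupExp I (t • v)) = lieGroupExp I (t • lieDifferential I f v) :=
  (lieGroupExp_smul_eq (γ := fun t : ℝ => f (lieGroupExp I (t • v)))
    (by rw [zero_smul, lieGroupExp_zero, map_one])
    ((isMIntegralCurve_lieGroupExp v).comp_of_related hf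
      (mfderiv_rightInvariantVectorField hf v)) t).symm

end LieDifferential

/-! ### The adjoint representation -/

section Adjoint

variable {E : Type*} [NormedAddCommGroup E] [NormedSpace ℝ E]
  {H : Type*} [TopologicalSpace H] {I : ModelWithCorners ℝ E H}
  {G : Type*} [TopologicalSpace G] [ChartedSpace H G] [Group G] [LieGroup I ∞ G]

theorem mdifferentiable_conj (g : G) : MDifferentiable I I (MulAut.conj g : G → G) :=
  ((contMDiff_mul_right (I := I) (n := ∞) (a := g⁻¹)).comp
    (contMDiff_mul_left (I := I) (n := ∞) (a := g))).mdifferentiable (by simp)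

variable (I G) in
/-- The adjoint representation of a Lie group on its Lie algebra. -/
noncomputable def lieAd : G →* Module.End ℝ (GroupLieAlgebra I G) where
  toFun g := (lieDifferential I (MulAut.conj g : G → G) : _ →L[ℝ] _)
  map_one' := by
    have h : (MulAut.conj (1 : G) : G → G) = id := by ext; simp
    rw [h, lieDifferential_id]
    rfl
  map_mul' g h := by
    have hc : (MulAut.conj (g * h) : G → G) = MulAut.conj g ∘ MulAut.conj h := by
      ext; simp
    rw [hc, lieDifferential_comp (mdifferentiable_conj g) (mdifferentiable_conj h) (map_one _)]
    rfl

/-- The tangent map of `(g, x) ↦ g x g⁻¹` at `(0_g, v)` is `Ad g v`. The fibre over `1` is embedded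
in the tangent bundle, so continuity can be tested there. -/
theorem continuous_lieAd_apply (v : GroupLieAlgebra I G) :
    Continuous fun g => lieAd I G g v := by
  have : IsManifold I 1 G := IsManifold.of_le (n := ∞) (by simp)
  rw [(FiberBundle.totalSpaceMk_isInducing E (TangentSpace I) (1 : G)).continuous_iff]
  let fg : G → TangentBundle I G := fun g ↦ Bundle.TotalSpace.mk' E g 0
  have sfg : ContMDiff I I.tangent 1 fg := Bundle.contMDiff_zeroSection _ _
  let fv : G → TangentBundle I G := fun _ ↦ Bundle.TotalSpace.mk' E 1 v
  have sfv : ContMDiff I I.tangent 1 fv := contMDiff_const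
  let F₁ : G → (TangentBundle I G × TangentBundle I G) := fun g ↦ (fg g, fv g)
  have S₁ : ContMDiff I (I.tangent.prod I.tangent) 1 F₁ := sfg.prodMk sfv
  let F₂ : (TangentBundle I G × TangentBundle I G) → TangentBundle (I.prod I) (G × G) :=
    (equivTangentBundleProd I G I G).symm
  have S₂ : ContMDiff (I.tangent.prod I.tangent) (I.prod I).tangent 1 F₂ :=
    contMDiff_equivTangentBundleProd_symm
  let c : G × G → G := fun p => p.1 * p.2 * p.1⁻¹
  have hc : ContMDiff (I.prod I) I ∞ c := (contMDiff_fst.mul contMDiff_snd).mul contMDiff_fst.inv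
  let F₃ : TangentBundle (I.prod I) (G × G) → TangentBundle I G := tangentMap (I.prod I) I c
  have S₃ : ContMDiff (I.prod I).tangent I.tangent 1 F₃ :=
    ContMDiff.contMDiff_tangentMap (n := ∞) hc (by norm_cast)
  have S := ((S₃.comp S₂).comp S₁).continuous
  refine (congrArg Continuous (funext fun g => Bundle.TotalSpace.ext ?_ ?_)).mpr S
  · simp [F₁, F₂, F₃, fg, fv, c]
  · refine heq_of_eq ?_
    simp only [Function.comp_apply, tangentMap, F₃, F₂, F₁, fg, fv]
    rw [mfderiv_prod_eq_add_apply (hc.mdifferentiableAt (by simp))]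
    exact ((congrArg (· + _) (map_zero _)).trans (zero_add _)).symm

/-- Left translation by `g` is conjugation by `g` followed by right translation by `g`. -/
theorem mulInvariant_eq_rightInvariant_of_fixed {v : GroupLieAlgebra I G}
    (hv : ∀ g, lieAd I G g v = v) (g : G) :
    mulInvariantVectorField v g = rightInvariantVectorField I v g := by
  have h := mfderiv_comp_apply_of_eq (I := I) (I' := I) (I'' := I) (f := (MulAut.conj g : G → G))
    (g := fun x : G => x * g) 1 (mdifferentiable_mul_right_const g 1) (mdifferentiable_conj g 1)
    (map_one _) v
  have hc : (fun x : G => x * g) ∘ (MulAut.conj g : G → G) = fun x => g * x := by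
    ext; simp
  rw [hc] at h
  exact h.trans (congrArg (fun u : GroupLieAlgebra I G =>
    (mfderiv I I (fun x : G => x * g) 1 u : E)) (hv g))

theorem eq_zero_of_lieAd_fixed [I.Boundaryless] [CompleteSpace E]
    (hss : LieAlgebra.IsSemisimple ℝ (GroupLieAlgebra I G)) {v : GroupLieAlgebra I G}
    (hv : ∀ g, lieAd I G g v = v) : v = 0 := by
  have h : v ∈ LieAlgebra.center ℝ (GroupLieAlgebra I G) := by
    rw [LieModule.mem_maxTrivSubmodule]
    intro w
    rw [← lie_skew,
      mlieBracket_eq_zero_of_biinvariant (mulInvariant_eq_rightInvariant_of_fixed hv), neg_zero]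
  rwa [LieAlgebra.center_eq_bot, LieSubmodule.mem_bot] at h

theorem comm_of_lieAd_eq_one [I.Boundaryless] [PreconnectedSpace G] {c : G}
    (hc : lieAd I G c = 1) (g : G) : c * g = g * c := by
  have h := eq_id_of_lieDifferential_eq_id (f := (MulAut.conj c).toMonoidHom)
    (mdifferentiable_conj (I := I) c)
    (ContinuousLinearMap.ext fun v => congrArg (fun L : Module.End ℝ _ => L v) hc) g
  rw [MulEquiv.toMonoidHom_eq_coe, MonoidHom.coe_coe, MulAut.conj_apply] at h
  exact mul_inv_eq_iff_eq_mul.1 h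

theorem conj_lieGroupExp [I.Boundaryless] [T2Space G] [CompleteSpace E] (g : G)
    (v : GroupLieAlgebra I G) (t : ℝ) :
    g * lieGroupExp I (t • v) * g⁻¹ = lieGroupExp I (t • lieAd I G g v) :=
  map_lieGroupExp (f := (MulAut.conj g).toMonoidHom) (mdifferentiable_conj g) v t

open Matrix Module in
theorem exists_basis_lieAd_orthogonal [T2Space G] [CompactSpace G] (hdim : finrank ℝ E = 3) :
    ∃ b : Basis (Fin 3) ℝ (GroupLieAlgebra I G), ∀ g,
      (LinearMap.toMatrix b b (lieAd I G g))ᵀ * LinearMap.toMatrix b b (lieAd I G g) = 1 := by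
  have : T2Space (GroupLieAlgebra I G) := inferInstanceAs (T2Space E)
  have : FiniteDimensional ℝ E := .of_finrank_pos (by omega)
  have : FiniteDimensional ℝ (GroupLieAlgebra I G) := inferInstanceAs (FiniteDimensional ℝ E)
  have : IsTopologicalGroup G := topologicalGroup_of_lieGroup I ∞
  exact exists_basis_orthogonal hdim (lieAd I G) continuous_lieAd_apply

end Adjoint

/-! ### Passage to an orthogonal basis of the Lie algebra -/

section Coordinates

open Matrix Module

theorem equivFun_symm_toMatrix_mulVec {V : Type*} [AddCommGroup V] [Module ℝ V]
    (b : Basis (Fin 3) ℝ V) (L : V →ₗ[ℝ] V) (x : Fin 3 → ℝ) :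
    b.equivFun.symm (LinearMap.toMatrix b b L *ᵥ x) = L (b.equivFun.symm x) := by
  rw [LinearEquiv.symm_apply_eq, Basis.equivFun_apply, ← LinearMap.toMatrix_mulVec_repr b b,
    ← Basis.equivFun_apply, LinearEquiv.apply_symm_apply]

variable {E : Type*} [NormedAddCommGroup E] [NormedSpace ℝ E] [CompleteSpace E]
  {H : Type*} [TopologicalSpace H] {I : ModelWithCorners ℝ E H} [I.Boundaryless]
  {G : Type*} [TopologicalSpace G] [T2Space G] [ConnectedSpace G]
  [ChartedSpace H G] [Group G] [LieGroup I ∞ G]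

/-- The adjoint representation and the one-parameter subgroups in a basis of the Lie algebra in
which the adjoint representation is orthogonal. -/
noncomputable def orthogonalAdjointOfBasis
    (hss : LieAlgebra.IsSemisimple ℝ (GroupLieAlgebra I G))
    (b : Basis (Fin 3) ℝ (GroupLieAlgebra I G))
    (hb : ∀ g, (LinearMap.toMatrix b b (lieAd I G g))ᵀ * LinearMap.toMatrix b b (lieAd I G g) = 1) :
    OrthogonalAdjoint G where
  Ad := ((LinearMap.toMatrixAlgEquiv b : _ →* Matrix (Fin 3) (Fin 3) ℝ)).comp (lieAd I G)
  exp v t := lieGroupExp I (t • b.equivFun.symm v)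
  continuous_Ad := by
    refine continuous_matrix fun i j => ?_
    have : T2Space (GroupLieAlgebra I G) := inferInstanceAs (T2Space E)
    have : FiniteDimensional ℝ (GroupLieAlgebra I G) := b.finiteDimensional_of_finite
    have : Continuous (b.coord i) := (b.coord i).continuous_of_finiteDimensional
    simpa [LinearMap.toMatrixAlgEquiv_apply, Function.comp_def] using
      this.comp (continuous_lieAd_apply (b j))
  transpose_mul_self := hb
  exp_add v s t := lieGroupExp_add_smul _ s t
  continuous_exp v := (isMIntegralCurve_lieGroupExp _).continuous
  exp_smul c v t := by rw [map_smul, smul_smul, mul_comm]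
  exp_injective v w h := b.equivFun.symm.injective (lieGroupExp_injective h)
  conj_exp g v t := by
    rw [conj_lieGroupExp]
    exact congrArg (fun u : GroupLieAlgebra I G => lieGroupExp I (t • u))
      (equivFun_symm_toMatrix_mulVec b _ v).symm
  eq_zero_of_fixed v h := by
    refine b.equivFun.symm.map_eq_zero_iff.1 (eq_zero_of_lieAd_fixed hss fun g => ?_)
    rw [← equivFun_symm_toMatrix_mulVec]
    exact congrArg _ (h g)
  comm_of_Ad_eq_one c h := comm_of_lieAd_eq_one (I := I)
    ((LinearMap.toMatrixAlgEquiv b).injective (h.trans (map_one _).symm))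

theorem exists_orthogonalAdjoint [CompactSpace G] (hdim : finrank ℝ E = 3)
    (hss : LieAlgebra.IsSemisimple ℝ (GroupLieAlgebra I G)) :
    ∃ (b : Basis (Fin 3) ℝ (GroupLieAlgebra I G)) (𝒜 : OrthogonalAdjoint G),
      ∀ v t, 𝒜.exp v t = lieGroupExp I (t • b.equivFun.symm v) := by
  obtain ⟨b, hb⟩ := exists_basis_lieAd_orthogonal (I := I) (G := G) hdim
  exact ⟨b, orthogonalAdjointOfBasis hss b hb, fun _ _ => rfl⟩

end Coordinates

/-! ### Flows: uniqueness and the group law -/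

section Flow

variable {E : Type*} [NormedAddCommGroup E] [NormedSpace ℝ E]
  {H : Type*} [TopologicalSpace H] {I : ModelWithCorners ℝ E H} [I.Boundaryless]
  {G : Type*} [TopologicalSpace G] [T2Space G] [ChartedSpace H G] [Group G] [LieGroup I ∞ G]
  {V : (g : G) → TangentSpace I g}

theorem IsFlowOf.unique (hV : ContMDiff I I.tangent 1 (fun g : G => (⟨g, V g⟩ : TangentBundle I G)))
    {φ φ' : ℝ → G → G} (hφ : IsFlowOf I V φ) (hφ' : IsFlowOf I V φ') : φ = φ' := by
  ext t g
  exact congrFun (isMIntegralCurve_unique hV (hφ.isMIntegralCurve g) (hφ'.isMIntegralCurve g)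
    (t₀ := 0) (by rw [hφ.map_zero, hφ'.map_zero])) t

theorem IsFlowOf.add_apply
    (hV : ContMDiff I I.tangent 1 (fun g : G => (⟨g, V g⟩ : TangentBundle I G)))
    {φ : ℝ → G → G} (hφ : IsFlowOf I V φ) (s t : ℝ) (g : G) : φ (s + t) g = φ s (φ t g) :=
  congrFun (isMIntegralCurve_unique hV ((hφ.isMIntegralCurve g).comp_add t)
    (hφ.isMIntegralCurve (φ t g)) (t₀ := 0) (by simp [hφ.map_zero])) s

end Flow

/-! ### Periodicity of linear flows and the main theorem -/

open Matrix Module in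
/-- A flow of automorphisms of a compact connected semisimple Lie group of dimension three is
periodic. -/
theorem IsLinearVectorField.exists_period
    {E : Type*} [NormedAddCommGroup E] [NormedSpace ℝ E] [CompleteSpace E]
    {H : Type*} [TopologicalSpace H] {I : ModelWithCorners ℝ E H} [I.Boundaryless]
    {G : Type*} [TopologicalSpace G] [T2Space G] [CompactSpace G] [ConnectedSpace G]
    [ChartedSpace H G] [Group G] [LieGroup I ∞ G]
    (hdim : finrank ℝ E = 3)
    (hss : LieAlgebra.IsSemisimple ℝ (GroupLieAlgebra I G))
    {V : (g : G) → TangentSpace I g} (hV : IsLinearVectorField I V) {φ : ℝ → G → G}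
    (hφ : IsFlowOf I V φ) : ∃ T : ℝ, 0 < T ∧ ∀ g, φ T g = g := by
  obtain ⟨b, 𝒜, h𝒜⟩ := exists_orthogonalAdjoint hdim hss
  have hV1 := hV.contMDiff.of_le (m := 1) (by norm_cast)
  obtain ⟨φ', hφ', haut⟩ := hV.exists_flow
  -- Linearity only provides some flow by automorphisms; uniqueness identifies it with `φ`.
  obtain rfl := hφ.unique hV1 hφ'
  choose ψ hψ _ hψφ using haut
  have hψd : ∀ t, MDifferentiable I I (ψ t) := fun t => (hψ t).mdifferentiable (by simp)
  let D : ℝ → Matrix (Fin 3) (Fin 3) ℝ := fun t =>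
    LinearMap.toMatrix b b (lieDifferential I (ψ t) : _ →L[ℝ] _)
  have hψ0 : (ψ 0 : G → G) = id := funext fun g => (hψφ 0 g).trans (hφ.map_zero g)
  have hψadd : ∀ s t, (ψ (s + t) : G → G) = ψ s ∘ ψ t := fun s t => funext fun g => by
    rw [Function.comp_apply, hψφ, hψφ, hψφ, hφ.add_apply hV1]
  obtain ⟨T, hT, hDT⟩ := 𝒜.exists_period_of_flow (f := ψ) (D := D)
    (by
      simp only [D, hψ0, lieDifferential_id]
      exact LinearMap.toMatrix_id b)
    (fun s t => by
      simp only [D, hψadd]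
      rw [lieDifferential_comp (hψd s) (hψd t) (map_one _)]
      exact LinearMap.toMatrix_comp b b b _ _)
    (fun t v s => by
      rw [h𝒜, h𝒜, equivFun_symm_toMatrix_mulVec]
      exact map_lieGroupExp (f := (ψ t).toMonoidHom) (hψd t) _ s)
    (fun g => by
      simp only [hψφ]
      exact (hφ.isMIntegralCurve g).continuous)
  refine ⟨T, hT, fun g => ?_⟩
  have hd : lieDifferential I (ψ T) = ContinuousLinearMap.id ℝ _ := by
    refine ContinuousLinearMap.coe_injective ((LinearMap.toMatrix b b).injective ?_)
    exact hDT.trans (LinearMap.toMatrix_id b).symm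
  rw [← hψφ]
  exact eq_id_of_lieDifferential_eq_id (f := (ψ T).toMonoidHom) (hψd T) hd g

theorem mainTheorem6
    {E : Type*} [NormedAddCommGroup E] [NormedSpace ℝ E] [CompleteSpace E]
    {H : Type*} [TopologicalSpace H] (I : ModelWithCorners ℝ E H) [I.Boundaryless]
    (G : Type*) [TopologicalSpace G] [T2Space G] [CompactSpace G] [ConnectedSpace G]
    [ChartedSpace H G] [Group G] [LieGroup I ∞ G]
    (hdim : Module.finrank ℝ E = 3)
    (hss : LieAlgebra.IsSemisimple ℝ (GroupLieAlgebra I G)) :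
    (∀ X : GroupLieAlgebra I G,
      IsFlowOf I (rightInvariantVectorField I X) (fun t g => lieGroupExp I (t • X) * g) ∧
      (X ≠ 0 → ∀ g : G, IsPeriodicOrbit (fun t : ℝ => lieGroupExp I (t • X) * g))) ∧
    (∀ (V : (g : G) → TangentSpace I g) (φ : ℝ → G → G),
      IsLinearVectorField I V → IsFlowOf I V φ →
      ∀ g : G, (∀ t : ℝ, φ t g = g) ∨ IsPeriodicOrbit (fun t : ℝ => φ t g)) := by
  refine ⟨fun X => ⟨isFlowOf_lieGroupExp X, fun hX g => ⟨?_, ?_⟩⟩, fun V φ hV hφ g => ?_⟩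
  · by_contra! h
    refine hX (lieGroupExp_injective fun t => ?_)
    have ht := mul_right_cancel (h t)
    rw [ht, zero_smul, smul_zero]
  · obtain ⟨b, 𝒜, h𝒜⟩ := exists_orthogonalAdjoint hdim hss
    obtain ⟨T, hT, hT1⟩ := 𝒜.exists_exp_eq_one (b.equivFun X)
    rw [h𝒜, LinearEquiv.symm_apply_apply] at hT1
    exact ⟨T, hT, fun t => by beta_reduce; rw [lieGroupExp_add_smul, hT1, mul_one]⟩
  · obtain ⟨T, hT, hTφ⟩ := hV.exists_period hdim hss hφ
    have hV1 := hV.contMDiff.of_le (m := 1) (by norm_cast)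
    by_cases h : ∀ t, φ t g = g
    · exact .inl h
    · push Not at h
      obtain ⟨t, ht⟩ := h
      exact .inr ⟨⟨t, by beta_reduce; rwa [hφ.map_zero]⟩, T, hT, fun t => by
        beta_reduce
        rw [hφ.add_apply hV1, hTφ]⟩
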